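/- Fix a prime $p$. Let $\mathrm{Aff}$ be the category of affine schemes with the étale topology, and $\mathrm{Sh}$ its category of sheaves of sets. For a commutative ring $R$ let $W_n(R)=R^{n+1}$ be the ring of truncated $p$-typical Witt vectors $(x_0,\dots,x_n)$ in Buium–Joyal components, with truncations $\tau\colon W_{n+1}(R)\to W_n(R)$ and with the ring homomorphisms $\Delta\colon W_{m+n}(R)\to W_n(W_m(R))$, $(x_0,\dots,x_{m+n})\mapsto((x_0,\dots,x_m),\dots,(x_n,\dots,x_{m+n}))$. For $X\in\mathrm{Sh}$ put $J^n(X)(T)=X(W_n(T))$ and $J(X)=\lim_n J^n(X)$; the maps $\Delta$ make $J$ a comonad with counit the projection $u\colon J(X)\to J^0(X)=X$. A $\delta$-sheaf is a sheaf with a coaction of the comonad $J$. Let $S$ be a $\delta$-sheaf with structure map $\alpha_S\colon S\to J(S)$. A $\delta_S$-sheaf is a $\delta$-sheaf with a $\delta$-morphism to $S$. For a sheaf $X$ over $S$ put $J_S(X)=J(X)\times_{J(S)}S$ and $J^1_S(X)=J^1(X)\times_{J^1(S)}S$, with projections $u\colon J_S(X)\to J^1_S(X)$ and $u\colon J^1_S(X)\to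 X$. A sheaf is ind-affine if it is a filtered colimit of affine schemes. Let $\mathscr C$ be the category of pairs $(X,\beta)$ where $X$ is an ind-affine sheaf over $S$ and $\beta\colon X\to J^1_S(X)$ is a section of $u\colon J^1_S(X)\to X$, a morphism $(X,\beta)\to(X',\beta')$ being a morphism $f\colon X\to X'$ over $S$ with $\beta'\circ f=J^1_S(f)\circ\beta$. Then the functor $X\mapsto(X,\alpha_1)$ from the category of ind-affine $\delta_S$-sheaves (a full subcategory of all $\delta_S$-sheaves) to $\mathscr C$, where $\alpha_1$ is the composite $X\xrightarrow{\alpha}J_S(X)\xrightarrow{u}J^1_S(X)$ of the structure map $\alpha$ with $u$, is an equivalence of categories. Moreover, for every commutative ring $R$ and every $n\ge 1$, the map $\Delta\colon W_{n+1}(R)\to W_n(W_1(R))$ is the equaliser of the two maps $\tau,\ \Delta\circ W_n(\tau)\colon W_n(W_1(R))\rightrightarrows W_{n-1}(W_1(R))$. -/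

import Mathlib

open CategoryTheory CategoryTheory.Limits Opposite

universe u v

noncomputable section

namespace DeltaJet

section WittVectors

/-! ### The ring of pairs `(x, δ x)` -/

/-- The polynomial `∑_{i=1}^{p-1} (1/p) * binom(p,i) * x^i * y^(p-i)`. -/
def leib (p : ℕ) {A : Type u} [CommRing A] (x y : A) : A :=
  ∑ i ∈ Finset.Ioo 0 p, ((p.choose i / p : ℕ) : A) * x ^ i * y ^ (p - i)

theorem map_leib (p : ℕ) {A : Type u} {B : Type v} [CommRing A] [CommRing B] (f : A →+* B)
    (x y : A) : f (leib p x y) = leib p (f x) (f y) := by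
  simp [leib, map_sum]

theorem add_pow_leib (p : ℕ) [hp : Fact p.Prime] {A : Type u} [CommRing A] (x y : A) :
    (x + y) ^ p = x ^ p + y ^ p + p * leib p x y := by
  have h1 : Finset.range (p + 1) = insert 0 (insert p (Finset.Ioo 0 p)) := by
    ext i; simp only [Finset.mem_range, Finset.mem_insert, Finset.mem_Ioo]; omega
  have hp0 := hp.out.pos
  rw [add_pow, h1, Finset.sum_insert (by simp; omega), Finset.sum_insert (by simp), leib,
    Finset.mul_sum]
  have h2 : ∀ i ∈ Finset.Ioo 0 p, x ^ i * y ^ (p - i) * ((p.choose i : ℕ) : A) =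
      p * (((p.choose i / p : ℕ) : A) * x ^ i * y ^ (p - i)) := by
    intro i hi
    rw [Finset.mem_Ioo] at hi
    have : p.choose i = p * (p.choose i / p) :=
      (Nat.mul_div_cancel' (hp.out.dvd_choose_self hi.1.ne' hi.2)).symm
    conv_lhs => rw [this]
    push_cast
    ring
  rw [Finset.sum_congr rfl h2]
  simp
  ring

theorem leib_zero_left (p : ℕ) {A : Type u} [CommRing A] (y : A) : leib p 0 y = 0 :=
  Finset.sum_eq_zero fun i hi => by
    rw [Finset.mem_Ioo] at hi
    simp [hi.1.ne']

/-- An identity between integral polynomials in three variables may be checked after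
multiplication by `p`. -/
theorem eq_of_universal (p : ℕ) [hp : Fact p.Prime] {A : Type u} [CommRing A]
    (F G : MvPolynomial (Fin 3) ℤ) (h : (p : MvPolynomial (Fin 3) ℤ) * F = p * G)
    (a b c : A) : MvPolynomial.aeval ![a, b, c] F = MvPolynomial.aeval ![a, b, c] G := by
  have : F = G := mul_left_cancel₀ (Nat.cast_ne_zero.mpr hp.out.ne_zero) h
  rw [this]

theorem leib_comm (p : ℕ) [hp : Fact p.Prime] {A : Type u} [CommRing A] (x y : A) :
    leib p x y = leib p y x := by
  have := eq_of_universal p (leib p (MvPolynomial.X 0) (MvPolynomial.X 1))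
    (leib p (MvPolynomial.X 1) (MvPolynomial.X 0)) (by
      have h1 := add_pow_leib p (MvPolynomial.X 0 : MvPolynomial (Fin 3) ℤ) (MvPolynomial.X 1)
      have h2 := add_pow_leib p (MvPolynomial.X 1 : MvPolynomial (Fin 3) ℤ) (MvPolynomial.X 0)
      rw [add_comm (MvPolynomial.X 1 : MvPolynomial (Fin 3) ℤ)] at h2
      linear_combination h2 - h1) x y 0
  have e : ∀ P Q : MvPolynomial (Fin 3) ℤ, MvPolynomial.aeval ![x, y, 0] (leib p P Q) =
      leib p (MvPolynomial.aeval ![x, y, 0] P) (MvPolynomial.aeval ![x, y, 0] Q) :=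
    fun P Q => map_leib p (MvPolynomial.aeval ![x, y, (0 : A)] : _ →ₐ[ℤ] A).toRingHom P Q
  simpa [e] using this

theorem leib_assoc (p : ℕ) [hp : Fact p.Prime] {A : Type u} [CommRing A] (x y z : A) :
    leib p x y + leib p (x + y) z = leib p y z + leib p x (y + z) := by
  have := eq_of_universal p
    (leib p (MvPolynomial.X 0) (MvPolynomial.X 1) +
      leib p (MvPolynomial.X 0 + MvPolynomial.X 1) (MvPolynomial.X 2))
    (leib p (MvPolynomial.X 1) (MvPolynomial.X 2) +
      leib p (MvPolynomial.X 0) (MvPolynomial.X 1 + MvPolynomial.X 2)) (by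
      have h1 := add_pow_leib p (MvPolynomial.X 0 : MvPolynomial (Fin 3) ℤ) (MvPolynomial.X 1)
      have h2 := add_pow_leib p (MvPolynomial.X 1 : MvPolynomial (Fin 3) ℤ) (MvPolynomial.X 2)
      have h3 := add_pow_leib p (MvPolynomial.X 0 + MvPolynomial.X 1 :
        MvPolynomial (Fin 3) ℤ) (MvPolynomial.X 2)
      have h4 := add_pow_leib p (MvPolynomial.X 0 : MvPolynomial (Fin 3) ℤ)
        (MvPolynomial.X 1 + MvPolynomial.X 2)
      rw [← add_assoc] at h4
      linear_combination h4 + h2 - h3 - h1) x y z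
  have e : ∀ P Q : MvPolynomial (Fin 3) ℤ, MvPolynomial.aeval ![x, y, z] (leib p P Q) =
      leib p (MvPolynomial.aeval ![x, y, z] P) (MvPolynomial.aeval ![x, y, z] Q) :=
    fun P Q => map_leib p (MvPolynomial.aeval ![x, y, z] : _ →ₐ[ℤ] A).toRingHom P Q
  simpa [e] using this

theorem leib_mul (p : ℕ) {A : Type u} [CommRing A] (x y z : A) :
    leib p (x * z) (y * z) = z ^ p * leib p x y := by
  rw [leib, leib, Finset.mul_sum]
  refine Finset.sum_congr rfl fun i hi => ?_
  rw [Finset.mem_Ioo] at hi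
  rw [mul_pow, mul_pow]
  conv_rhs => rw [show p = i + (p - i) by omega, pow_add]
  simp only [Nat.add_sub_cancel_left]
  have : i + (p - i) = p := by omega
  rw [this]
  ring

/-- Pairs `(x, δ x)` of elements of `A`. -/
@[ext] structure Pair (p : ℕ) (A : Type u) where
  /-- the element `x` -/
  fst : A
  /-- its image `δ x` -/
  snd : A

namespace Pair

variable {p : ℕ} {A : Type u} [CommRing A]

instance : Zero (Pair p A) := ⟨⟨0, 0⟩⟩
instance : One (Pair p A) := ⟨⟨1, 0⟩⟩
/-- The Leibniz rule for `δ (x + y)`. -/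
instance : Add (Pair p A) := ⟨fun x y => ⟨x.fst + y.fst, x.snd + y.snd - leib p x.fst y.fst⟩⟩
/-- The Leibniz rule for `δ (x * y)`. -/
instance : Mul (Pair p A) :=
  ⟨fun x y => ⟨x.fst * y.fst, x.fst ^ p * y.snd + x.snd * y.fst ^ p + p * x.snd * y.snd⟩⟩
instance : Neg (Pair p A) := ⟨fun x => ⟨-x.fst, -x.snd + leib p (-x.fst) x.fst⟩⟩

@[simp] theorem zero_fst : (0 : Pair p A).fst = 0 := rfl
@[simp] theorem zero_snd : (0 : Pair p A).snd = 0 := rfl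
@[simp] theorem one_fst : (1 : Pair p A).fst = 1 := rfl
@[simp] theorem one_snd : (1 : Pair p A).snd = 0 := rfl
@[simp] theorem add_fst (x y : Pair p A) : (x + y).fst = x.fst + y.fst := rfl
@[simp] theorem add_snd (x y : Pair p A) :
    (x + y).snd = x.snd + y.snd - leib p x.fst y.fst := rfl
@[simp] theorem mul_fst (x y : Pair p A) : (x * y).fst = x.fst * y.fst := rfl
@[simp] theorem mul_snd (x y : Pair p A) :
    (x * y).snd = x.fst ^ p * y.snd + x.snd * y.fst ^ p + p * x.snd * y.snd := rfl
@[simp] theorem neg_fst (x : Pair p A) : (-x).fst = -x.fst := rfl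
@[simp] theorem neg_snd (x : Pair p A) : (-x).snd = -x.snd + leib p (-x.fst) x.fst := rfl

variable [hp : Fact p.Prime]

instance : CommRing (Pair p A) where
  add_assoc x y z := by
    ext
    · simp [add_assoc]
    · simp only [add_fst, add_snd]
      linear_combination -leib_assoc p x.fst y.fst z.fst
  zero_add x := by ext <;> simp [leib_zero_left]
  add_zero x := by ext <;> simp [leib_comm p x.fst 0, leib_zero_left]
  add_comm x y := by
    ext
    · simp [add_comm]
    · simp only [add_snd]
      rw [leib_comm p x.fst]; ring
  neg_add_cancel x := by ext <;> simp
  left_distrib x y z := by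
    ext
    · simp [mul_add]
    · simp only [add_fst, add_snd, mul_fst, mul_snd]
      rw [add_pow_leib, mul_comm x.fst, mul_comm x.fst, leib_mul]
      ring
  right_distrib x y z := by
    ext
    · simp [add_mul]
    · simp only [add_fst, add_snd, mul_fst, mul_snd]
      rw [add_pow_leib, leib_mul]
      ring
  zero_mul x := by ext <;> simp [hp.out.ne_zero]
  mul_zero x := by ext <;> simp [hp.out.ne_zero]
  mul_assoc x y z := by
    ext
    · simp [mul_assoc]
    · simp only [mul_fst, mul_snd]; ring
  one_mul x := by ext <;> simp
  mul_one x := by ext <;> simp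
  mul_comm x y := by
    ext
    · simp [mul_comm]
    · simp only [mul_snd]; ring
  nsmul := nsmulRec
  zsmul := zsmulRec

/-- The projection `(x, δ x) ↦ x`. -/
def fstHom (p : ℕ) [Fact p.Prime] (A : Type u) [CommRing A] : Pair p A →+* A where
  toFun x := x.fst
  map_one' := rfl
  map_mul' _ _ := rfl
  map_zero' := rfl
  map_add' _ _ := rfl

/-- Functoriality of pairs. -/
def map (p : ℕ) [Fact p.Prime] {A : Type u} {B : Type v} [CommRing A] [CommRing B] (f : A →+* B) :
    Pair p A →+* Pair p B where
  toFun x := ⟨f x.fst, f x.snd⟩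
  map_one' := by ext <;> simp
  map_mul' _ _ := by ext <;> simp
  map_zero' := by ext <;> simp
  map_add' _ _ := by ext <;> simp [map_leib]

end Pair

/-! ### Truncated `p`-typical Witt vectors in Buium–Joyal components -/

/-- The set `W_n(R) = R^{n+1}` of truncated Witt vectors `(x_0, …, x_n)` in Buium–Joyal
components. -/
def Witt (_p : ℕ) (R : Type u) (n : ℕ) : Type u := Fin (n + 1) → R

namespace Witt

/-- The truncation `τ (x_0, …, x_{n+1}) = (x_0, …, x_n)`. -/
def τ (p : ℕ) {R : Type u} {n : ℕ} (x : Witt p R (n + 1)) : Witt p R n := fun i => x i.castSucc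

/-- The operator `δ (x_0, …, x_{n+1}) = (x_1, …, x_{n+1})`. -/
def δ (p : ℕ) {R : Type u} {n : ℕ} (x : Witt p R (n + 1)) : Witt p R n := fun i => x i.succ

/-- The map `x ↦ (τ x, δ x)`. -/
def toPair (p : ℕ) {R : Type u} {n : ℕ} (x : Witt p R (n + 1)) : Pair p (Witt p R n) :=
  ⟨τ p x, δ p x⟩

theorem toPair_injective (p : ℕ) {R : Type u} {n : ℕ} :
    Function.Injective (toPair p : Witt p R (n + 1) → Pair p (Witt p R n)) := by
  intro x y h
  have h1 : τ p x = τ p y := congrArg Pair.fst h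
  have h2 : δ p x = δ p y := congrArg Pair.snd h
  funext i
  refine Fin.cases ?_ (fun j => ?_) i
  · exact congrFun h1 0
  · exact congrFun h2 j

/-- A commutative ring structure on `W_n(R)` for which the image of `x ↦ (τ x, δ x)` on
`W_{n+1}(R)` is a subring of the ring of pairs. -/
structure Stage (p : ℕ) [Fact p.Prime] (R : Type u) (n : ℕ) where
  /-- the ring structure -/
  ring : CommRing (Witt p R n)
  /-- the image of `toPair` as a subring -/
  range : Subring (Pair p (Witt p R n))
  mem_range : ∀ z, z ∈ range ↔ ∃ x : Witt p R (n + 1), toPair p x = z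

section next

variable {p : ℕ} [Fact p.Prime] {R : Type u} {n : ℕ} (s : Stage p R n)

/-- `W_{n+1}(R)` is in bijection with the subring of pairs `(τ x, δ x)`. -/
def Stage.equiv : letI := s.ring; Witt p R (n + 1) ≃ s.range :=
  letI := s.ring
  Equiv.ofBijective (fun x => ⟨toPair p x, (s.mem_range _).2 ⟨x, rfl⟩⟩)
    ⟨fun _ _ h => toPair_injective p (congrArg Subtype.val h), fun z => by
      obtain ⟨x, hx⟩ := (s.mem_range z.1).1 z.2
      exact ⟨x, Subtype.ext hx⟩⟩

/-- The ring structure on `W_{n+1}(R)` defined by the Leibniz rules for `δ`. -/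
@[reducible] def Stage.nextRing : CommRing (Witt p R (n + 1)) :=
  letI := s.ring
  s.equiv.commRing

/-- The map `x ↦ (τ x, δ x)` as a ring homomorphism. -/
def Stage.toPairHom : letI := s.ring; letI := s.nextRing
    Witt p R (n + 1) →+* Pair p (Witt p R n) :=
  letI := s.ring; letI := s.nextRing
  s.range.subtype.comp (s.equiv.ringEquiv : Witt p R (n + 1) →+* s.range)

/-- The next stage of the recursion. -/
def Stage.next : Stage p R (n + 1) :=
  letI := s.ring; letI := s.nextRing
  { ring := s.nextRing
    range := RingHom.eqLocus (Pair.map p ((Pair.fstHom p _).comp s.toPairHom))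
      (s.toPairHom.comp (Pair.fstHom p _))
    mem_range := by
      rintro ⟨a, d⟩
      change Pair.mk (p := p) (τ p a) (τ p d) = ⟨τ p a, δ p a⟩ ↔ _
      constructor
      · intro h
        have h2 : τ p d = δ p a := congrArg Pair.snd h
        refine ⟨Fin.cons (a 0) d, Pair.ext ?_ ?_⟩
        · funext i
          refine Fin.cases rfl (fun j => ?_) i
          exact congrFun h2 j
        · rfl
      · rintro ⟨x, hx⟩
        have h1 : τ p x = a := congrArg Pair.fst hx
        have h2 : δ p x = d := congrArg Pair.snd hx
        subst h1 h2
        rfl }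

end next

/-- The ring structures on all `W_n(R)`, by recursion: on `W_0(R) = R` it is that of `R`. -/
def stage (p : ℕ) [Fact p.Prime] (R : Type u) [CommRing R] : ∀ n, Stage p R n
  | 0 =>
    letI : CommRing (Witt p R 0) := inferInstanceAs (CommRing (Fin 1 → R))
    { ring := inferInstance
      range := ⊤
      mem_range := fun z => ⟨fun _ => ⟨Fin.cons (z.fst 0) z.snd, by
        refine Pair.ext ?_ rfl
        funext i
        rw [show i = 0 from Fin.eq_zero i]
        rfl⟩, fun _ => trivial⟩ }
  | n + 1 => (stage p R n).next

/-- The ring structure on `W_n(R)`. It is the one for which `W_0(R) = R` as rings and, for all `n`,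
`τ : W_{n+1}(R) → W_n(R)` is a ring homomorphism and `δ : W_{n+1}(R) → W_n(R)` satisfies
`δ (x + y) = δ x + δ y - ∑ (1/p) binom(p,i) (τ x)^i (τ y)^(p-i)`,
`δ (x y) = (τ x)^p δ y + δ x (τ y)^p + p δ x δ y` and `δ 1 = 0`, as recorded below. -/
instance instCommRing (p : ℕ) [Fact p.Prime] (R : Type u) [CommRing R] (n : ℕ) :
    CommRing (Witt p R n) := (stage p R n).ring

variable (p : ℕ) [Fact p.Prime] {R : Type u} [CommRing R] {S : Type v} [CommRing S]

/-- The identification `W_0(R) = R`. -/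
def zeroEquiv (R : Type u) [CommRing R] : R ≃+* Witt p R 0 where
  toFun a := fun _ => a
  invFun x := x 0
  left_inv _ := rfl
  right_inv x := by
    funext i
    rw [show i = 0 from Fin.eq_zero i]
  map_mul' _ _ := rfl
  map_add' _ _ := rfl

/-- The ring homomorphism `x ↦ (τ x, δ x)`. -/
def toPairHom (R : Type u) [CommRing R] (n : ℕ) :
    Witt p R (n + 1) →+* Pair p (Witt p R n) := (stage p R n).toPairHom

@[simp] theorem toPairHom_apply {n : ℕ} (x : Witt p R (n + 1)) :
    toPairHom p R n x = ⟨τ p x, δ p x⟩ := rfl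

/-- The truncation homomorphism `τ : W_{n+1}(R) → W_n(R)`. -/
def trunc (R : Type u) [CommRing R] (n : ℕ) : Witt p R (n + 1) →+* Witt p R n :=
  (Pair.fstHom p _).comp (toPairHom p R n)

@[simp] theorem trunc_apply {n : ℕ} (x : Witt p R (n + 1)) (i : Fin (n + 1)) :
    trunc p R n x i = x i.castSucc := rfl

theorem δ_one {n : ℕ} : δ p (1 : Witt p R (n + 1)) = 0 :=
  congrArg Pair.snd (map_one (toPairHom p R n))

theorem δ_add {n : ℕ} (x y : Witt p R (n + 1)) :
    δ p (x + y) = δ p x + δ p y - leib p (τ p x) (τ p y) :=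
  congrArg Pair.snd (map_add (toPairHom p R n) x y)

theorem δ_mul {n : ℕ} (x y : Witt p R (n + 1)) :
    δ p (x * y) = τ p x ^ p * δ p y + δ p x * τ p y ^ p + p * δ p x * δ p y :=
  congrArg Pair.snd (map_mul (toPairHom p R n) x y)

/-- A map to `W_{n+1}(R)` is a ring homomorphism if its composite with `x ↦ (τ x, δ x)` is. -/
def homMk {A : Type u} [CommRing A] {n : ℕ} (f : A → Witt p R (n + 1))
    (F : A →+* Pair p (Witt p R n)) (h : ∀ a, toPair p (f a) = F a) :
    A →+* Witt p R (n + 1) where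
  toFun := f
  map_one' := toPair_injective p <| by
    change _ = toPairHom p R n 1
    rw [h, map_one, map_one]
  map_mul' x y := toPair_injective p <| by
    change _ = toPairHom p R n (f x * f y)
    rw [h, map_mul, map_mul, ← h, ← h]; rfl
  map_zero' := toPair_injective p <| by
    change _ = toPairHom p R n 0
    rw [h, map_zero, map_zero]
  map_add' x y := toPair_injective p <| by
    change _ = toPairHom p R n (f x + f y)
    rw [h, map_add, map_add, ← h, ← h]; rfl

theorem exists_map {R S : Type u} [CommRing R] [CommRing S] (f : R →+* S) (n : ℕ) :
    ∃ g : Witt p R n →+* Witt p S n, ∀ x, g x = fun i => f (x i) := by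
  induction n with
  | zero =>
    refine ⟨((zeroEquiv p S : S →+* Witt p S 0).comp f).comp
      ((zeroEquiv p R).symm : Witt p R 0 →+* R), fun x => ?_⟩
    funext i
    rw [show i = 0 from Fin.eq_zero i]
    rfl
  | succ n ih =>
    obtain ⟨g, hg⟩ := ih
    refine ⟨homMk p (fun x i => f (x i)) ((Pair.map p g).comp (toPairHom p R n)) fun x => ?_,
      fun x => rfl⟩
    refine Pair.ext ?_ ?_
    · exact (hg (τ p x)).symm
    · exact (hg (δ p x)).symm

/-- Functoriality: `W_n(f) (x_0, …, x_n) = (f x_0, …, f x_n)`. -/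
def map {R S : Type u} [CommRing R] [CommRing S] (f : R →+* S) (n : ℕ) :
    Witt p R n →+* Witt p S n :=
  (exists_map p f n).choose.copy (fun x i => f (x i))
    (funext fun x => ((exists_map p f n).choose_spec x).symm)

@[simp] theorem map_apply {R S : Type u} [CommRing R] [CommRing S] (f : R →+* S) (n : ℕ)
    (x : Witt p R n) (i : Fin (n + 1)) : map p f n x i = f (x i) := rfl

theorem exists_comul (R : Type u) [CommRing R] (m n k : ℕ) (h : m + n = k) :
    ∃ g : Witt p R k →+* Witt p (Witt p R m) n,
      ∀ x, g x = fun (i : Fin (n + 1)) (j : Fin (m + 1)) => x ⟨i + j, by omega⟩ := by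
  induction n generalizing k with
  | zero =>
    obtain rfl : m = k := h
    refine ⟨(zeroEquiv p (Witt p R m) : Witt p R m →+* _), fun x => ?_⟩
    funext i j
    change x j = x _
    congr 1
    ext
    simp [show i = 0 from Fin.eq_zero i]
  | succ n ih =>
    subst h
    obtain ⟨g, hg⟩ := ih (m + n) rfl
    refine ⟨homMk p (fun x (i : Fin (n + 1 + 1)) (j : Fin (m + 1)) => x ⟨i + j, by omega⟩)
      ((Pair.map p g).comp (toPairHom p R (m + n))) fun x => ?_, fun x => rfl⟩
    refine Pair.ext ?_ ?_
    · refine Eq.trans ?_ (hg (τ p x)).symm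
      rfl
    · refine Eq.trans ?_ (hg (δ p x)).symm
      funext i j
      change x _ = x _
      congr 1
      ext
      simp
      omega

/-- The map `Δ : W_k(R) → W_n(W_m(R))`, for `k = m + n`, sending `(x_0, …, x_k)` to
`((x_0, …, x_m), (x_1, …, x_{m+1}), …, (x_n, …, x_{m+n}))`. -/
def comul (R : Type u) [CommRing R] (m n k : ℕ) (h : m + n = k) :
    Witt p R k →+* Witt p (Witt p R m) n :=
  (exists_comul p R m n k h).choose.copy
    (fun x (i : Fin (n + 1)) (j : Fin (m + 1)) => x ⟨i + j, by omega⟩)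
    (funext fun x => ((exists_comul p R m n k h).choose_spec x).symm)

@[simp] theorem comul_apply (R : Type u) [CommRing R] (m n k : ℕ) (h : m + n = k)
    (x : Witt p R k) (i : Fin (n + 1)) (j : Fin (m + 1)) :
    comul p R m n k h x i j = x ⟨i + j, by omega⟩ := rfl

end Witt

end WittVectors

section Jets

variable (p : ℕ) [Fact p.Prime]

/-- The functor `W_n` on commutative rings. -/
def wittFunctor (n : ℕ) : CommRingCat.{u} ⥤ CommRingCat.{u} where
  obj R := CommRingCat.of (Witt p R n)
  map f := CommRingCat.ofHom (Witt.map p f.hom n)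

/-- The truncation `τ : W_{n+1} → W_n`. -/
def wittTrunc (n : ℕ) : wittFunctor.{u} p (n + 1) ⟶ wittFunctor p n where
  app R := CommRingCat.ofHom (Witt.trunc p R n)

/-- The identification `W_0(R) = R`. -/
def wittZero : wittFunctor.{u} p 0 ⟶ 𝟭 CommRingCat.{u} where
  app R := CommRingCat.ofHom ((Witt.zeroEquiv p R).symm : Witt p R 0 →+* R)

/-- The map `Δ : W_k → W_n W_m` for `k = m + n`. -/
def wittComul (m n k : ℕ) (h : m + n = k) :
    wittFunctor.{u} p k ⟶ wittFunctor p m ⋙ wittFunctor p n where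
  app R := CommRingCat.ofHom (Witt.comul p R m n k h)

/-- The category of affine schemes. -/
abbrev Aff : Type (u + 1) := CommRingCat.{u}ᵒᵖ

/-- Presheaves of sets on the category of affine schemes. -/
abbrev PSh : Type (u + 1) := Aff.{u}ᵒᵖ ⥤ Type u

/-- The étale topology on affine schemes, generated by the jointly surjective families of étale
morphisms. -/
def etaleTopology : GrothendieckTopology Aff.{u} :=
  (AlgebraicGeometry.Scheme.etalePrecoverage.comap AlgebraicGeometry.Scheme.Spec).toGrothendieck

/-- The sheaves of sets on affine schemes for the étale topology. -/
def isSheaf : ObjectProperty PSh.{u} := fun X => Presheaf.IsSheaf etaleTopology X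

/-- The ind-affine sheaves: étale sheaves that are (small) filtered colimits of affine schemes.
As affine schemes are quasi-compact and quasi-separated, it does not matter whether this colimit is
taken in presheaves or in sheaves. -/
def isIndAffine : ObjectProperty PSh.{u} := fun X => isSheaf X ∧ IsIndObject X

/-- The `n`-th jet space functor `J^n(X)(T) = X(W_n(T))`, defined on presheaves. It sends étale
sheaves to étale sheaves, and so do the limits and fibre products formed from it below; as sheaves
are a full subcategory of presheaves, morphisms to jet spaces are those of presheaves. -/
def jetN (n : ℕ) : PSh.{u} ⥤ PSh.{u} :=
  (Functor.whiskeringLeft _ _ _).obj (wittFunctor p n).op.op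

/-- The projection `u : J^{n+1}(X) → J^n(X)`. -/
def jetTrunc (n : ℕ) : jetN.{u} p (n + 1) ⟶ jetN p n :=
  (Functor.whiskeringLeft _ _ _).map (NatTrans.op (NatTrans.op (wittTrunc p n)))

/-- The identification `J^0(X) = X`. -/
def jetZero : jetN.{u} p 0 ⟶ 𝟭 PSh.{u} where
  app X := { app := fun T => X.map ((wittZero p).app T.unop.unop).op.op
             naturality := fun T T' f => by
               change X.map ((wittFunctor p 0).map f.unop.unop).op.op ≫
                 X.map ((wittZero p).app T'.unop.unop).op.op =
                   X.map ((wittZero p).app T.unop.unop).op.op ≫ X.map f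
               rw [← X.map_comp, ← X.map_comp]
               refine congrArg X.map ?_
               exact congrArg (fun g : _ ⟶ T'.unop.unop => g.op.op)
                 ((wittZero p).naturality f.unop.unop) }
  naturality X Y f := by
    ext T : 2
    exact (f.naturality _).symm

/-- The projection `u : J^1(X) → J^0(X) = X`. -/
def jetOneProj : jetN.{u} p 1 ⟶ 𝟭 PSh.{u} := jetTrunc p 0 ≫ jetZero p

/-- The jet space `J(X)(T) = lim_n X(W_n(T))`. -/
def jetObj (X : PSh.{u}) : PSh.{u} where
  obj T := { x : ∀ n, ((jetN p n).obj X).obj T //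
    ∀ n, ((jetTrunc p n).app X).app T (x (n + 1)) = x n }
  map {T T'} f := TypeCat.ofHom fun x => ⟨fun n => ((jetN p n).obj X).map f (x.1 n), fun n => by
    refine (ConcreteCategory.congr_hom
      (((jetTrunc p n).app X).naturality f) (x.1 (n + 1))).trans ?_
    exact congrArg (((jetN p n).obj X).map f) (x.2 n)⟩

/-- The functor `X ↦ J(X)`. -/
def jetFunctor : PSh.{u} ⥤ PSh.{u} where
  obj X := jetObj p X
  map {X Y} f :=
    { app := fun T => TypeCat.ofHom fun x => ⟨fun n => ((jetN p n).map f).app T (x.1 n), fun n => by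
        refine (ConcreteCategory.congr_hom (NatTrans.congr_app
          ((jetTrunc p n).naturality f) T) (x.1 (n + 1))).trans ?_
        exact congrArg (((jetN p n).map f).app T) (x.2 n)⟩
      naturality := fun T T' g => by
        ext x
        apply Subtype.ext
        funext n
        exact ConcreteCategory.congr_hom (((jetN p n).map f).naturality g) (x.1 n) }

/-- The projection `u : J(X) → J^n(X)`. -/
def jetProj (n : ℕ) : jetFunctor.{u} p ⟶ jetN p n where
  app X := { app := fun T => TypeCat.ofHom fun x => x.1 n }

theorem jetProj_comp_jetTrunc (n : ℕ) : jetProj.{u} p (n + 1) ≫ jetTrunc p n = jetProj p n := by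
  ext X T x
  exact x.2 n

/-- The counit `u : J(X) → J^0(X) = X`. -/
def jetCounit : jetFunctor.{u} p ⟶ 𝟭 PSh.{u} := jetProj p 0 ≫ jetZero p

/-- The map `ν_{m,n} : J^k(X) → J^m(J^n(X))`, for `k = m + n`, induced by `Δ : W_k → W_n W_m`. -/
def jetComulN (m n k : ℕ) (h : m + n = k) : jetN.{u} p k ⟶ jetN p n ⋙ jetN p m :=
  (Functor.whiskeringLeft _ _ _).map (NatTrans.op (NatTrans.op (wittComul p m n k h)))

theorem jetComulN_congr {X : PSh.{u}} {T : Aff.{u}ᵒᵖ} (x : (jetObj p X).obj T) (m n k k' : ℕ)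
    (h : m + n = k) (h' : m + n = k') :
    ((jetComulN p m n k h).app X).app T (x.1 k) = ((jetComulN p m n k' h').app X).app T (x.1 k') := by
  subst h; subst h'; rfl

/-- An element of `J(X)(T)` gives an element of `J(J(X))(T)`, with components
`ν_{m,n} (x_{m+n}) ∈ X(W_n(W_m(T)))`. -/
def jetComulFun (X : PSh.{u}) (T : Aff.{u}ᵒᵖ) (x : (jetObj p X).obj T) :
    (jetObj p (jetObj p X)).obj T :=
  ⟨fun m => ⟨fun n => ((jetComulN p m n (m + n) rfl).app X).app T (x.1 (m + n)), fun n => by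
      refine Eq.trans ?_ (congrArg (((jetComulN p m n (m + n) rfl).app X).app T) (x.2 (m + n)))
      change (X.map _ ≫ X.map _) (x.1 (m + (n + 1))) = (X.map _ ≫ X.map _) (x.1 (m + (n + 1)))
      rw [← X.map_comp, ← X.map_comp]
      rfl⟩, fun m => by
    apply Subtype.ext
    funext n
    refine Eq.trans (congrArg _ (jetComulN_congr p x (m + 1) n (m + 1 + n) (m + n + 1) rfl
      (by omega))) ?_
    refine Eq.trans ?_ (congrArg (((jetComulN p m n (m + n) rfl).app X).app T) (x.2 (m + n)))
    change (X.map _ ≫ X.map _) (x.1 (m + n + 1)) = (X.map _ ≫ X.map _) (x.1 (m + n + 1))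
    rw [← X.map_comp, ← X.map_comp]
    rfl⟩

/-- The comultiplication `ν : J(X) → J(J(X))`. -/
def jetComul : jetFunctor.{u} p ⟶ jetFunctor p ⋙ jetFunctor p where
  app X :=
    { app := fun T => TypeCat.ofHom (jetComulFun p X T)
      naturality := fun T T' f => by
        ext x
        apply Subtype.ext
        funext m
        apply Subtype.ext
        funext n
        exact ConcreteCategory.congr_hom
          (((jetComulN p m n (m + n) rfl).app X).naturality f) (x.1 (m + n)) }
  naturality X Y f := by
    ext T x
    apply Subtype.ext
    funext m
    apply Subtype.ext
    funext n
    exact ConcreteCategory.congr_hom (NatTrans.congr_app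
      ((jetComulN p m n (m + n) rfl).naturality f) T) (x.1 (m + n))

/-- The comonad `J` whose coalgebras are the presheaves with a `δ`-structure. -/
def jetComonad : Comonad PSh.{u} where
  toFunctor := jetFunctor p
  ε := jetCounit p
  δ := jetComul p
  coassoc X := by
    ext T x
    apply Subtype.ext
    funext a
    apply Subtype.ext
    funext b
    apply Subtype.ext
    funext c
    refine Eq.trans (congrArg _ (jetComulN_congr p x a (b + c) (a + (b + c)) (a + b + c) rfl
      (by omega))) ?_
    change (X.map _ ≫ X.map _) (x.1 (a + b + c)) = (X.map _ ≫ X.map _) (x.1 (a + b + c))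
    rw [← X.map_comp, ← X.map_comp]
    refine congrArg (fun g : CommRingCat.of (Witt p T.unop.unop (a + b + c)) ⟶
      CommRingCat.of (Witt p (Witt p (Witt p T.unop.unop a) b) c) =>
        X.map g.op.op (x.1 (a + b + c))) ?_
    ext z
    funext i j k
    change z _ = z _
    congr 1
    ext
    simp [add_assoc]
  left_counit X := by
    ext T x
    apply Subtype.ext
    funext n
    refine Eq.trans (congrArg _ (jetComulN_congr p x 0 n (0 + n) n rfl (by omega))) ?_
    change (X.map _ ≫ X.map _) (x.1 n) = x.1 n
    rw [← X.map_comp]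
    refine Eq.trans (congrArg (fun g : CommRingCat.of (Witt p T.unop.unop n) ⟶
      CommRingCat.of (Witt p T.unop.unop n) => X.map g.op.op (x.1 n))
        (?_ : _ = 𝟙 (CommRingCat.of (Witt p T.unop.unop n)))) ?_
    · ext z
      funext i
      rfl
    · exact ConcreteCategory.congr_hom (X.map_id _) (x.1 n)
  right_counit X := by
    ext T x
    apply Subtype.ext
    funext n
    change (X.map _ ≫ X.map _) (x.1 n) = x.1 n
    rw [← X.map_comp]
    refine Eq.trans (congrArg (fun g : CommRingCat.of (Witt p T.unop.unop n) ⟶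
      CommRingCat.of (Witt p T.unop.unop n) => X.map g.op.op (x.1 n))
        (?_ : _ = 𝟙 (CommRingCat.of (Witt p T.unop.unop n)))) ?_
    · ext z
      funext i
      change z _ = z _
      congr 1
      ext
      simp
    · exact ConcreteCategory.congr_hom (X.map_id _) (x.1 n)

end Jets

section Relative

variable (p : ℕ) [Fact p.Prime] (S : (jetComonad.{u} p).Coalgebra)

/-- The structure map `α : S → J(S)` of a `δ`-structure on `S`. -/
def coact : S.A ⟶ (jetFunctor p).obj S.A := S.a

/-- The map `α_n : S → J(S) → J^n(S)` of a `δ`-structure `α` on `S`. -/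
def coactN (n : ℕ) : S.A ⟶ (jetN p n).obj S.A := coact p S ≫ (jetProj p n).app S.A

/-- The relative jet space functor `J^n_S(X) = J^n(X) ×_{J^n(S)} S`. -/
def relJetN (n : ℕ) : Over S.A ⥤ Over S.A :=
  Over.post (jetN p n) ⋙ Over.pullback (coactN p S n)

/-- The relative jet space functor `J_S(X) = J(X) ×_{J(S)} S`. -/
def relJet : Over S.A ⥤ Over S.A :=
  Over.post (jetFunctor p) ⋙ Over.pullback (coact p S)

theorem coactN_naturality {S S' : (jetComonad.{u} p).Coalgebra} (n : ℕ) (f : S ⟶ S') :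
    coactN p S n ≫ (jetN p n).map f.f = f.f ≫ coactN p S' n := by
  have h : coact p S ≫ (jetFunctor p).map f.f = f.f ≫ coact p S' := f.h
  rw [coactN, coactN, Category.assoc, ← (jetProj p n).naturality, ← Category.assoc, h,
    Category.assoc]

theorem jetProj_jetOneProj (X : PSh.{u}) :
    (jetProj p 1).app X ≫ (jetOneProj p).app X = (jetCounit p).app X := by
  have h := NatTrans.congr_app (jetProj_comp_jetTrunc.{u} p 0) X
  simp only [NatTrans.comp_app] at h
  simp only [jetOneProj, jetCounit, NatTrans.comp_app, ← h, Category.assoc]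

theorem coactN_jetOneProj : coactN p S 1 ≫ (jetOneProj p).app S.A = 𝟙 S.A := by
  rw [coactN, Category.assoc, jetProj_jetOneProj]
  exact S.counit

theorem relJetProj_condition (n : ℕ) {X : PSh.{u}} (f : X ⟶ S.A) :
    (pullback.fst ((jetFunctor p).map f) (coact p S) ≫ (jetProj p n).app X) ≫ (jetN p n).map f =
      pullback.snd ((jetFunctor p).map f) (coact p S) ≫ coactN p S n := by
  rw [Category.assoc, ← (jetProj p n).naturality, ← Category.assoc, pullback.condition, coactN,
    Category.assoc]

theorem relJetOneProj_condition {X : PSh.{u}} (f : X ⟶ S.A) :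
    (pullback.fst ((jetN p 1).map f) (coactN p S 1) ≫ (jetOneProj p).app X) ≫ f =
      pullback.snd ((jetN p 1).map f) (coactN p S 1) := by
  have h := (jetOneProj p).naturality f
  dsimp only [Functor.id_obj, Functor.id_map] at h
  rw [Category.assoc, ← h, ← Category.assoc, pullback.condition, Category.assoc,
    coactN_jetOneProj, Category.comp_id]

/-- The projection `u : J_S(X) → J^n_S(X)`. -/
def relJetProj (n : ℕ) (X : Over S.A) : (relJet p S).obj X ⟶ (relJetN p S n).obj X :=
  Over.homMk
    (pullback.lift (pullback.fst ((jetFunctor p).map X.hom) (coact p S) ≫ (jetProj p n).app X.left)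
      (pullback.snd ((jetFunctor p).map X.hom) (coact p S)) (relJetProj_condition p S n X.hom))
    (pullback.lift_snd _ _ _)

/-- The projection `u : J^1_S(X) → X` over `S`. -/
def relJetOneProj (X : Over S.A) : (relJetN p S 1).obj X ⟶ X :=
  Over.homMk (pullback.fst ((jetN p 1).map X.hom) (coactN p S 1) ≫ (jetOneProj p).app X.left)
    (relJetOneProj_condition p S X.hom)

end Relative

/-- The category of `δ`-sheaves: étale sheaves on affine schemes with a coaction of `J`. -/
abbrev DeltaSheaf (p : ℕ) [Fact p.Prime] : Type (u + 1) :=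
  (isSheaf.{u}.inverseImage (jetComonad.{u} p).forget).FullSubcategory

section Equivalence

variable {p : ℕ} [Fact p.Prime] (S : DeltaSheaf.{u} p)

/-- The `S`-sheaf underlying a `δ_S`-sheaf, i.e. an object of the slice category of `δ`-sheaves
over `S`. -/
def underlying : Over S ⥤ Over S.obj.A :=
  Over.post ((isSheaf.inverseImage (jetComonad p).forget).ι ⋙ (jetComonad p).forget)

/-- The category of ind-affine `δ_S`-sheaves, a full subcategory of the category of
`δ_S`-sheaves. -/
abbrev IndAffineDeltaSheaf : Type (u + 1) :=
  ObjectProperty.FullSubcategory (fun X : Over S => isIndAffine X.left.obj.A)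

/-- The structure map `α : X → J_S(X)` of a `δ_S`-sheaf. -/
def relCoact (X : Over S) :
    (underlying S).obj X ⟶ (relJet p S.obj).obj ((underlying S).obj X) :=
  Over.homMk (pullback.lift (coact p X.left.obj) X.hom.hom.f X.hom.hom.h) (pullback.lift_snd _ _ _)

/-- The map `α_1 : X → J_S(X) → J^1_S(X)` of a `δ_S`-sheaf. -/
def relCoactOne (X : Over S) :
    (underlying S).obj X ⟶ (relJetN p S.obj 1).obj ((underlying S).obj X) :=
  relCoact S X ≫ relJetProj p S.obj 1 _

theorem relCoactOne_fst (X : Over S) :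
    (relCoactOne S X).left ≫
      pullback.fst ((jetN p 1).map X.hom.hom.f) (coactN p S.obj 1) = coactN p X.left.obj 1 := by
  refine (Category.assoc _ _ _).trans ?_
  refine (congrArg (fun t => (relCoact S X).left ≫ t) (pullback.lift_fst _ _ _)).trans ?_
  refine (Category.assoc _ _ _).symm.trans ?_
  exact congrArg (fun t => t ≫ (jetProj p 1).app X.left.obj.A) (pullback.lift_fst _ _ _)

theorem relCoactOne_proj (X : Over S) :
    relCoactOne S X ≫ relJetOneProj p S.obj _ = 𝟙 ((underlying S).obj X) := by
  apply Over.OverMorphism.ext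
  refine (Category.assoc _ _ _).symm.trans ?_
  refine (congrArg (fun t => t ≫ (jetOneProj p).app X.left.obj.A) (relCoactOne_fst S X)).trans ?_
  exact coactN_jetOneProj p X.left.obj

theorem relCoactOne_naturality {X Y : Over S} (f : X ⟶ Y) :
    relCoactOne S X ≫ (relJetN p S.obj 1).map ((underlying S).map f) =
      (underlying S).map f ≫ relCoactOne S Y := by
  apply Over.OverMorphism.ext
  apply pullback.hom_ext
  · refine (Category.assoc _ _ _).trans ?_
    refine (congrArg (fun t => (relCoactOne S X).left ≫ t) (pullback.lift_fst _ _ _)).trans ?_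
    refine (Category.assoc _ _ _).symm.trans ?_
    refine (congrArg (fun t => t ≫ (jetN p 1).map f.left.hom.f) (relCoactOne_fst S X)).trans ?_
    refine Eq.trans ?_ (Category.assoc _ _ _).symm
    refine Eq.trans ?_ (congrArg (fun t => f.left.hom.f ≫ t) (relCoactOne_fst S Y)).symm
    exact coactN_naturality p 1 f.left.hom
  · exact (Over.w (relCoactOne S X ≫ (relJetN p S.obj 1).map ((underlying S).map f))).trans
      (Over.w ((underlying S).map f ≫ relCoactOne S Y)).symm

/-- The property of a pair `(X, β)`, where `X` is an object over `S` and `β : X → J^1_S(X)` is a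
morphism over `S`, that `X` is an ind-affine sheaf and that `β` is a section of the projection
`u : J^1_S(X) → X`. -/
def isJetSection : ObjectProperty (Endofunctor.Coalgebra (relJetN p S.obj 1)) :=
  fun C => isIndAffine C.V.left ∧ C.str ≫ relJetOneProj p S.obj C.V = 𝟙 C.V

/-- The category of pairs `(X, β)`, where `X` is an ind-affine sheaf over `S` and
`β : X → J^1_S(X)` is a section of the projection `u`; a morphism `(X, β) → (X', β')` is a morphism
`f : X → X'` over `S` such that `J^1_S(f) ∘ β = β' ∘ f`. -/
abbrev JetSection : Type (u + 1) := (isJetSection S).FullSubcategory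

/-- The functor `X ↦ (X, α_1)`. -/
def toJetSection : IndAffineDeltaSheaf S ⥤ JetSection S where
  obj X := ⟨⟨(underlying S).obj X.obj, relCoactOne S X.obj⟩, X.property, relCoactOne_proj S X.obj⟩
  map f := ObjectProperty.homMk ⟨(underlying S).map f.hom, relCoactOne_naturality S f.hom⟩

end Equivalence

end DeltaJet

end

noncomputable section

namespace DeltaJet

/-! ### Frobenius lift, `p`-torsion and the kernel of truncation -/

namespace Witt

variable (p : ℕ) [Fact p.Prime] {R : Type u} [CommRing R]

/-! A coaction of `J` on `X` is a compatible family of maps `α_n : X(R) → X(W_n(R))`, and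
coassociativity gives `Δ(α_{n+1} x) = α_n(α_1 x)` in `X(W_n(W_1(R)))`. So `α_1` determines every
`α_n` as soon as `Δ : W_{n+1}(R) → W_n(W_1(R))` is injective on points of `X`, and a section `β`
extends to a coaction as soon as the point `α_n(β x)` descends along `Δ`.

Injectivity holds for every presheaf, because `Δ` has a left inverse `r` that is a ring homomorphism
(`retraction`, `retraction_comul`). In ghost components `r` only forgets entries, but in Buium–Joyal
components it requires dividing a difference of `p`-th powers by `p`. The two elements concerned
differ by some `(0, …, 0, c)`, whose `p`-th power is explicitly `p` times another such element, so
the quotient has an integral formula. Multiplicativity and additivity of `r` are checked over rings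
without `p`-torsion, where `τ` and the Frobenius lift detect ring homomorphisms, and pass to all
rings by naturality. This gives fullness through `homOfCoactNOne`.

Descent uses that `Δ` is an equaliser (`exists_comul_eq`), which is visible on components, and that
points of an ind-affine `X` descend along equalisers of rings (`exists_push_of_isIndObject`): the
category of affine schemes over `X` is filtered, so an equality of two points is realised on a
single affine. Hence `α_{n+1} = r ∘ α_n ∘ β` defines the coaction; `iterFun_spec` and
`push_comul_iterFun` verify the axioms, giving essential surjectivity. -/

theorem one_add_eq (n : ℕ) : 1 + n = n + 1 := Nat.add_comm 1 n

@[simp] theorem trunc_eq_τ {n : ℕ} (x : Witt p R (n + 1)) : trunc p R n x = τ p x := rfl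

theorem τ_zero {n : ℕ} : τ p (0 : Witt p R (n + 1)) = 0 := map_zero (trunc p R n)

theorem τ_add {n : ℕ} (x y : Witt p R (n + 1)) : τ p (x + y) = τ p x + τ p y :=
  map_add (trunc p R n) x y

theorem τ_sub {n : ℕ} (x y : Witt p R (n + 1)) : τ p (x - y) = τ p x - τ p y :=
  map_sub (trunc p R n) x y

theorem τ_mul {n : ℕ} (x y : Witt p R (n + 1)) : τ p (x * y) = τ p x * τ p y :=
  map_mul (trunc p R n) x y

theorem δ_zero {n : ℕ} : δ p (0 : Witt p R (n + 1)) = 0 :=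
  congrArg Pair.snd (map_zero (toPairHom p R n))

omit [Fact p.Prime] in
theorem ext_τ_δ {R : Type u} {n : ℕ} {x y : Witt p R (n + 1)} (h : τ p x = τ p y)
    (h' : δ p x = δ p y) : x = y :=
  toPair_injective p (Pair.ext h h')

/-- The Frobenius lift `x ↦ x ^ p + p δ x` on pairs. -/
def _root_.DeltaJet.Pair.frob (A : Type u) [CommRing A] : Pair p A →+* A where
  toFun x := x.fst ^ p + p * x.snd
  map_one' := by simp
  map_zero' := by simp [(Fact.out : p.Prime).ne_zero]
  map_mul' x y := by simp only [Pair.mul_fst, Pair.mul_snd]; ring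
  map_add' x y := by simp only [Pair.add_fst, Pair.add_snd, add_pow_leib]; ring

/-- The Frobenius lift `F : W_{n+1}(R) → W_n(R)`. -/
def frob (R : Type u) [CommRing R] (n : ℕ) : Witt p R (n + 1) →+* Witt p R n :=
  (Pair.frob p _).comp (toPairHom p R n)

theorem frob_apply {n : ℕ} (x : Witt p R (n + 1)) :
    frob p R n x = τ p x ^ p + p * δ p x := rfl

/-- By induction both `τ x` and the Frobenius lift of `x` vanish; then `p * δ x = 0`, and induction
applies once more to `δ x`. -/
theorem eq_zero_of_natCast_mul (hR : ∀ a : R, (p : R) * a = 0 → a = 0) {n : ℕ} (x : Witt p R n)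
    (h : (p : Witt p R n) * x = 0) : x = 0 := by
  induction n with
  | zero =>
    have h' := congrArg (zeroEquiv p R).symm h
    rw [map_mul, map_natCast, map_zero] at h'
    exact (zeroEquiv p R).symm.injective ((hR _ h').trans (map_zero _).symm)
  | succ n ih =>
    have h1 : τ p x = 0 := ih _ <| by
      have := congrArg (trunc p R n) h
      rwa [map_mul, map_natCast, map_zero] at this
    have h2 : frob p R n x = 0 := ih _ <| by
      have := congrArg (frob p R n) h
      rwa [map_mul, map_natCast, map_zero] at this
    rw [frob_apply, h1, zero_pow (Fact.out : p.Prime).ne_zero, zero_add] at h2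
    exact ext_τ_δ p (h1.trans (τ_zero p).symm) ((ih _ h2).trans (δ_zero p).symm)

theorem natCast_mul_injective (hR : ∀ a : R, (p : R) * a = 0 → a = 0) {n : ℕ}
    {x y : Witt p R n} (h : (p : Witt p R n) * x = p * y) : x = y :=
  sub_eq_zero.1 (eq_zero_of_natCast_mul p hR _ (by rw [mul_sub, h, sub_self]))

/-- In the absence of `p`-torsion, `δ`, which is not additive, can be traded for the Frobenius lift,
which is a ring homomorphism. -/
theorem ext_τ_frob (hR : ∀ a : R, (p : R) * a = 0 → a = 0) {n : ℕ} {x y : Witt p R (n + 1)}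
    (h : τ p x = τ p y) (h' : frob p R n x = frob p R n y) : x = y := by
  refine ext_τ_δ p h (natCast_mul_injective p hR ?_)
  rw [frob_apply, frob_apply, h] at h'
  exact add_left_cancel h'

/-- The element `(0, …, 0, c)` of `W_n(R)`. -/
def last (n : ℕ) (c : R) : Witt p R n := fun i => if i = Fin.last n then c else 0

theorem zero_apply {n : ℕ} (i : Fin (n + 1)) : (0 : Witt p R n) i = 0 := by
  induction n with
  | zero => rfl
  | succ n ih =>
    refine Fin.cases ?_ (fun j => ?_) i
    · exact (congrFun (τ_zero p (R := R)) 0).trans (ih 0)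
    · exact (congrFun (δ_zero p (R := R)) j).trans (ih j)

theorem τ_last (n : ℕ) (c : R) : τ p (last p (n + 1) c) = 0 := by
  funext i
  rw [zero_apply]
  exact if_neg (Fin.castSucc_lt_last i).ne

omit [Fact p.Prime] in
theorem δ_last (n : ℕ) (c : R) : δ p (last p (n + 1) c) = last p n c := by
  funext i
  simp [δ, last, ← Fin.succ_last]

theorem eq_last_of_τ_eq_zero {n : ℕ} (x : Witt p R (n + 1)) (h : τ p x = 0) :
    x = last p (n + 1) (x (Fin.last _)) := by
  funext i
  refine Fin.lastCases ?_ (fun j => ?_) i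
  · simp [last]
  · exact (congrFun h j).trans (congrFun (τ_last p n _) j).symm

theorem last_zero_eq (c : R) : last p 0 c = zeroEquiv p R c := by
  funext i
  rw [show i = 0 from Fin.eq_zero i]
  rfl

theorem last_add (n : ℕ) (c d : R) : last p n (c + d) = last p n c + last p n d := by
  induction n with
  | zero => simp only [last_zero_eq, map_add]
  | succ n ih =>
    refine ext_τ_δ p ?_ ?_
    · rw [τ_add, τ_last, τ_last, τ_last, add_zero]
    · rw [δ_add, τ_last, τ_last, leib_zero_left, sub_zero, δ_last, δ_last, δ_last, ih]

/-- The additive map `c ↦ (0, …, 0, c)`. -/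
def lastHom (R : Type u) [CommRing R] (n : ℕ) : R →+ Witt p R n :=
  AddMonoidHom.mk' (last p n) (last_add p n)

theorem last_natCast_mul (n k : ℕ) (c : R) : last p n (k * c) = k * last p n c := by
  have h := map_nsmul (lastHom p R n) k c
  rw [nsmul_eq_mul, nsmul_eq_mul] at h
  exact h

/-- When `τ x = τ y = 0` the product rule reduces to `δ (x y) = p δ x δ y`, so each level
contributes one factor `p`. -/
theorem last_mul (n : ℕ) (c d : R) : last p n c * last p n d = last p n (p ^ n * (c * d)) := by
  induction n with
  | zero => simp only [last_zero_eq, pow_zero, one_mul, map_mul]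
  | succ n ih =>
    refine ext_τ_δ p ?_ ?_
    · rw [τ_mul, τ_last, τ_last, τ_last, zero_mul]
    · rw [δ_mul, τ_last, τ_last, zero_pow (Fact.out : p.Prime).ne_zero, δ_last, δ_last, δ_last,
        mul_assoc, ih, ← last_natCast_mul]
      ring_nf

theorem last_pow (n k : ℕ) (c : R) :
    last p n c ^ (k + 1) = last p n (p ^ (n * k) * c ^ (k + 1)) := by
  induction k with
  | zero => simp only [mul_zero, pow_zero, zero_add, pow_one, one_mul]
  | succ k ih =>
    rw [pow_succ, ih, last_mul]
    congr 1
    ring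

/-- The `p - 1` products give the factor `p ^ ((n + 1) * (p - 1))`, whose exponent is positive;
pulling out one `p` divides the power by `p` without any torsion hypothesis. -/
theorem last_pow_prime (n : ℕ) (c : R) :
    last p (n + 1) c ^ p = p * last p (n + 1) (p ^ ((n + 1) * (p - 1) - 1) * c ^ p) := by
  have hp : 2 ≤ p := (Fact.out : p.Prime).two_le
  obtain ⟨k, rfl⟩ : ∃ k, p = k + 2 := ⟨p - 2, by omega⟩
  rw [last_pow (k + 2) (n + 1) (k + 1), ← last_natCast_mul]
  congr 1
  have : (n + 1) * (k + 1) = (n + 1) * (k + 2 - 1) - 1 + 1 := by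
    rw [Nat.sub_add_cancel]
    · rfl
    · exact Nat.mul_pos n.succ_pos (by omega)
  rw [this, pow_succ]
  ring

theorem map_last {S : Type u} [CommRing S] (f : R →+* S) (n : ℕ) (c : R) :
    map p f n (last p n c) = last p n (f c) := by
  funext i
  simp only [map_apply, last]
  split <;> simp

/-! ### The retraction of `Δ : W_{n+1}(R) → W_n(W_1(R))` -/

/-- The ring homomorphism `W_n(τ) : W_n(W_1(R)) → W_n(R)`. -/
def mapTrunc (R : Type u) [CommRing R] (n : ℕ) : Witt p (Witt p R 1) n →+* Witt p R n :=
  map p ((zeroEquiv p R).symm.toRingHom.comp (trunc p R 0)) n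

/-- The element `c + (a ^ p - b ^ p) / p` of `W_{n+1}(R)`, for `a` and `b` with the same image in
`W_n(R)`. -/
def addDivPow {n : ℕ} (a b c : Witt p R (n + 1)) : Witt p R (n + 1) :=
  c + leib p b (a - b) +
    last p (n + 1) (p ^ ((n + 1) * (p - 1) - 1) * (a - b) (Fin.last (n + 1)) ^ p)

/-- Expand `a ^ p = (b + (a - b)) ^ p`. The mixed terms are `p` times `leib`, and `a - b` lies in
the kernel of `τ`, so `last_pow_prime` handles `(a - b) ^ p`. -/
theorem natCast_mul_addDivPow {n : ℕ} {a b : Witt p R (n + 1)} (c : Witt p R (n + 1))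
    (h : τ p a = τ p b) : b ^ p + p * addDivPow p a b c = a ^ p + p * c := by
  have h0 := eq_last_of_τ_eq_zero p (a - b) (by rw [τ_sub, h, sub_self])
  have h1 := add_pow_leib p b (a - b)
  rw [add_sub_cancel] at h1
  rw [addDivPow, mul_add, mul_add, ← last_pow_prime, ← h0, h1]
  ring

theorem τ_addDivPow {n : ℕ} {a b : Witt p R (n + 1)} (c : Witt p R (n + 1))
    (h : τ p a = τ p b) : τ p (addDivPow p a b c) = τ p c := by
  rw [addDivPow, τ_add, τ_add, τ_last, ← trunc_eq_τ p (leib p _ _), map_leib, map_sub]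
  rw [trunc_eq_τ, trunc_eq_τ, h, sub_self, leib_comm, leib_zero_left, add_zero, add_zero]

theorem map_addDivPow {S : Type u} [CommRing S] (f : R →+* S) {n : ℕ}
    (a b c : Witt p R (n + 1)) :
    map p f (n + 1) (addDivPow p a b c) =
      addDivPow p (map p f _ a) (map p f _ b) (map p f _ c) := by
  rw [addDivPow, addDivPow, map_add, map_add, map_leib, map_last, map_mul, map_pow, map_pow,
    map_natCast, ← map_apply p f (n + 1), map_sub]

/-- The map `W_n(W_1(R)) → W_{n+1}(R)` which, in ghost components, is
`((w_{00}, w_{01}), …, (w_{n0}, w_{n1})) ↦ (w_{00}, …, w_{n0}, w_{n1})`. -/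
def retractionFun (R : Type u) [CommRing R] : ∀ n, Witt p (Witt p R 1) n → Witt p R (n + 1)
  | 0, z => z 0
  -- The value of `δ` is forced by asking that `r` commute with Frobenius lifts: `(τ (r z)) ^ p + p
  -- δ (r z) = r (τ z) ^ p + p r (δ z)`, where `τ (r z)` is `mapTrunc z`.
  | n + 1, z => (Fin.cons (z 0 0) (addDivPow p (retractionFun R n (τ p z))
      (mapTrunc p R (n + 1) z) (retractionFun R n (δ p z))) : Fin (n + 1 + 1 + 1) → R)

theorem δ_retractionFun {n : ℕ} (z : Witt p (Witt p R 1) (n + 1)) :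
    δ p (retractionFun p R (n + 1) z) = addDivPow p (retractionFun p R n (τ p z))
      (mapTrunc p R (n + 1) z) (retractionFun p R n (δ p z)) := rfl

theorem map_retractionFun {S : Type u} [CommRing S] (f : R →+* S) (n : ℕ)
    (z : Witt p (Witt p R 1) n) :
    map p f (n + 1) (retractionFun p R n z) =
      retractionFun p S n (map p (map p f 1) n z) := by
  induction n with
  | zero => rfl
  | succ n ih =>
    funext i
    refine Fin.cases rfl (fun j => ?_) i
    refine congrFun ((map_addDivPow p f _ _ _).trans ?_) j
    rw [ih, ih]
    rfl

theorem τ_retractionFun {n : ℕ} (z : Witt p (Witt p R 1) n) :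
    τ p (retractionFun p R n z) = mapTrunc p R n z := by
  induction n with
  | zero =>
    funext i
    rw [show i = 0 from Fin.eq_zero i]
    rfl
  | succ n ih =>
    funext i
    refine Fin.cases rfl (fun j => ?_) i
    -- The induction hypothesis at `τ z` shows that `r (τ z)` and `mapTrunc z` have equal
    -- truncations, which is what makes the correction term vanish under `τ`.
    exact (congrFun (τ_addDivPow p (retractionFun p R n (δ p z)) (ih (τ p z))) j).trans
      (congrFun (ih (δ p z)) j)

theorem frob_retractionFun {n : ℕ} (z : Witt p (Witt p R 1) (n + 1)) :
    frob p R (n + 1) (retractionFun p R (n + 1) z) =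
      retractionFun p R n (τ p z) ^ p + p * retractionFun p R n (δ p z) := by
  rw [frob_apply, τ_retractionFun, δ_retractionFun, natCast_mul_addDivPow]
  exact τ_retractionFun p (τ p z)

/-- For `R` without `p`-torsion, a map to `W_{n+1}(R)` is a ring homomorphism if its composites with
`τ` and the Frobenius lift are. -/
def homMkFrob (hR : ∀ a : R, (p : R) * a = 0 → a = 0) {A : Type u} [CommRing A] {n : ℕ}
    (f : A → Witt p R (n + 1)) (g h : A →+* Witt p R n) (hg : ∀ a, τ p (f a) = g a)
    (hh : ∀ a, frob p R n (f a) = h a) : A →+* Witt p R (n + 1) where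
  toFun := f
  map_one' := ext_τ_frob p hR (by rw [hg, ← trunc_eq_τ, map_one, map_one])
    (by rw [hh, map_one, map_one])
  map_mul' x y := ext_τ_frob p hR (by rw [hg, τ_mul, map_mul, hg, hg])
    (by rw [hh, map_mul, map_mul, hh, hh])
  map_zero' := ext_τ_frob p hR (by rw [hg, τ_zero, map_zero]) (by rw [hh, map_zero, map_zero])
  map_add' x y := ext_τ_frob p hR (by rw [hg, τ_add, map_add, hg, hg])
    (by rw [hh, map_add, map_add, hh, hh])

/-- Here `τ ∘ r = mapTrunc`, and the Frobenius lift composed with `r` is the previous `r` composed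
with the Frobenius lift, a ring homomorphism by induction. -/
theorem exists_retraction_of_torsionFree (hR : ∀ a : R, (p : R) * a = 0 → a = 0) (n : ℕ) :
    ∃ r : Witt p (Witt p R 1) n →+* Witt p R (n + 1), ∀ z, r z = retractionFun p R n z := by
  induction n with
  | zero => exact ⟨((zeroEquiv p (Witt p R 1)).symm : _ →+* Witt p R 1), fun z => rfl⟩
  | succ n ih =>
    obtain ⟨r, hr⟩ := ih
    refine ⟨homMkFrob p hR (retractionFun p R (n + 1)) (mapTrunc p R (n + 1))
      (r.comp (frob p _ n)) (τ_retractionFun p) fun z => ?_, fun z => rfl⟩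
    rw [frob_retractionFun, ← hr, ← hr, RingHom.comp_apply, frob_apply, map_add, map_mul, map_pow,
      map_natCast]

theorem exists_retraction (R : Type u) [CommRing R] (n : ℕ) :
    ∃ r : Witt p (Witt p R 1) n →+* Witt p R (n + 1), ∀ z, r z = retractionFun p R n z := by
  -- The polynomial ring with one variable per element of `R` has no `p`-torsion and surjects onto
  -- `R`; by naturality the identities for `r` descend to `R`.
  let f : MvPolynomial R ℤ →+* R := (MvPolynomial.aeval id : MvPolynomial R ℤ →ₐ[ℤ] R).toRingHom
  have hf : Function.Surjective f := fun a => ⟨MvPolynomial.X a, MvPolynomial.aeval_X _ _⟩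
  obtain ⟨r, hr⟩ := exists_retraction_of_torsionFree p (R := MvPolynomial R ℤ) (fun a ha =>
    (mul_eq_zero.1 ha).resolve_left (Nat.cast_ne_zero.2 (Fact.out : p.Prime).ne_zero)) n
  let F := map p (map p f 1) n
  have hF : Function.Surjective F := fun z =>
    ⟨fun i j => (hf (z i j)).choose, funext fun i => funext fun j => (hf (z i j)).choose_spec⟩
  have key : ∀ z, retractionFun p R n (F z) = (map p f (n + 1)).comp r z := fun z => by
    rw [RingHom.comp_apply, hr, map_retractionFun]
  refine ⟨{ toFun := retractionFun p R n, map_one' := ?_, map_mul' := fun x y => ?_,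
            map_zero' := ?_, map_add' := fun x y => ?_ }, fun z => rfl⟩
  · rw [← map_one F, key, map_one]
  · obtain ⟨x, rfl⟩ := hF x
    obtain ⟨y, rfl⟩ := hF y
    rw [← map_mul, key, key, key, map_mul]
  · change retractionFun p R n 0 = 0
    rw [← map_zero F, key, map_zero]
  · change retractionFun p R n (x + y) = retractionFun p R n x + retractionFun p R n y
    obtain ⟨x, rfl⟩ := hF x
    obtain ⟨y, rfl⟩ := hF y
    rw [← map_add, key, key, key, map_add]

/-- The ring homomorphism `W_n(W_1(R)) → W_{n+1}(R)` given by `retractionFun`. -/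
def retraction (R : Type u) [CommRing R] (n : ℕ) :
    Witt p (Witt p R 1) n →+* Witt p R (n + 1) :=
  (exists_retraction p R n).choose.copy (retractionFun p R n)
    (funext fun z => ((exists_retraction p R n).choose_spec z).symm)

theorem retraction_apply {n : ℕ} (z : Witt p (Witt p R 1) n) :
    retraction p R n z = retractionFun p R n z := rfl

/-! ### The equaliser property of `Δ` -/

theorem δ_comul {n : ℕ} (x : Witt p R (n + 1 + 1)) :
    δ p (comul p R 1 (n + 1) (n + 1 + 1) (one_add_eq _) x) =
      comul p R 1 n (n + 1) (one_add_eq _) (δ p x) := by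
  funext i j
  simp only [δ, comul_apply]
  congr 1
  ext
  simp only [Fin.val_succ]
  omega

theorem τ_comul {n : ℕ} (x : Witt p R (n + 1 + 1)) :
    τ p (comul p R 1 (n + 1) (n + 1 + 1) (one_add_eq _) x) =
      comul p R 1 n (n + 1) (one_add_eq _) (τ p x) := rfl

theorem mapTrunc_comul {n : ℕ} (x : Witt p R (n + 1)) :
    mapTrunc p R n (comul p R 1 n (n + 1) (one_add_eq _) x) = τ p x := rfl

theorem addDivPow_self {n : ℕ} (a c : Witt p R (n + 1)) : addDivPow p a a c = c := by
  rw [addDivPow, sub_self, leib_comm, leib_zero_left, zero_apply,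
    zero_pow (Fact.out : p.Prime).ne_zero, mul_zero, ← sub_self (0 : R)]
  have : last p (n + 1) (0 : R) = 0 := map_zero (lastHom p R (n + 1))
  rw [sub_self, this, add_zero, add_zero]

/-- For `z = Δ x`, induction gives `r (τ z) = τ x = mapTrunc z`. The difference of `p`-th powers is
then zero, and `δ` commutes with `Δ`. -/
theorem retraction_comul {n : ℕ} (x : Witt p R (n + 1)) :
    retraction p R n (comul p R 1 n (n + 1) (one_add_eq _) x) = x := by
  rw [retraction_apply]
  induction n with
  | zero =>
    funext i
    change x _ = x i
    congr 1
    ext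
    simp
  | succ n ih =>
    refine ext_τ_δ p ?_ ?_
    · rw [τ_retractionFun, mapTrunc_comul]
    · rw [δ_retractionFun, τ_comul, ih, mapTrunc_comul, addDivPow_self, δ_comul, ih]

theorem comul_injective (n : ℕ) :
    Function.Injective (comul p R 1 n (n + 1) (one_add_eq _)) :=
  Function.LeftInverse.injective (g := retraction p R n) (retraction_comul p)

/-- Both sides are `Δ (τ x)`. -/
theorem trunc_comul {n : ℕ} (x : Witt p R (n + 2)) :
    trunc p (Witt p R 1) n (comul p R 1 (n + 1) (n + 2) (one_add_eq _) x) =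
      comul p R 1 n (n + 1) (one_add_eq _) (mapTrunc p R (n + 1)
        (comul p R 1 (n + 1) (n + 2) (one_add_eq _) x)) := rfl

theorem exists_comul_eq {n : ℕ} (z : Witt p (Witt p R 1) (n + 1))
    (h : trunc p (Witt p R 1) n z =
      comul p R 1 n (n + 1) (one_add_eq _) (mapTrunc p R (n + 1) z)) :
    ∃ x, comul p R 1 (n + 1) (n + 2) (one_add_eq _) x = z := by
  -- The hypothesis says `z k 1 = z (k + 1) 0`, so the rows of `z` overlap and are the windows of
  -- length two of `(z 0 0, z 0 1, z 1 1, …, z (n + 1) 1)`.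
  refine ⟨Fin.cons (z 0 0) fun i => z i 1, ?_⟩
  funext i j
  have h' : ∀ k : Fin (n + 1), z k.castSucc 1 = z k.succ 0 := fun k =>
    congrFun (congrFun h k) 1
  fin_cases j
  · refine Fin.cases rfl (fun k => ?_) i
    exact h' k
  · rfl

end Witt

/-! ### Points of presheaves and equalisers of rings -/

section Push

/-- The value of a presheaf on affine schemes on a commutative ring. -/
abbrev Points (X : PSh.{u}) (R : Type u) [CommRing R] : Type u := X.obj (op (op (CommRingCat.of R)))

/-- The map on points induced by a ring homomorphism. -/
def push (X : PSh.{u}) {R R' : Type u} [CommRing R] [CommRing R'] (g : R →+* R') :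
    Points X R → Points X R' := X.map (CommRingCat.ofHom g).op.op

variable {X Y : PSh.{u}} {R R' R'' : Type u} [CommRing R] [CommRing R'] [CommRing R'']

theorem push_comp (g : R →+* R') (h : R' →+* R'') (x : Points X R) :
    push X (h.comp g) x = push X h (push X g x) :=
  ConcreteCategory.congr_hom
    (X.map_comp (CommRingCat.ofHom g).op.op (CommRingCat.ofHom h).op.op) x

theorem push_id (x : Points X R) : push X (RingHom.id R) x = x :=
  ConcreteCategory.congr_hom (X.map_id _) x

theorem push_congr {g h : R →+* R'} (e : ∀ a, g a = h a) (x : Points X R) :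
    push X g x = push X h x := by
  rw [RingHom.ext e]

/-- Any functor preserves split injections, so nothing is asked of `X`. This is the use made of the
retraction of `Δ`. -/
theorem push_injective {g : R →+* R'} {h : R' →+* R} (e : ∀ a, h (g a) = a) :
    Function.Injective (push X g) := fun x y hxy => by
  have h' := congrArg (push X h) hxy
  rwa [← push_comp, ← push_comp, RingHom.ext (f := h.comp g) (g := RingHom.id R) e, push_id,
    push_id] at h'

/-- The map on points induced by a morphism of presheaves. -/
def onPoints (f : X ⟶ Y) (R : Type u) [CommRing R] : Points X R → Points Y R := f.app _

theorem onPoints_push (f : X ⟶ Y) (g : R →+* R') (x : Points X R) :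
    onPoints f R' (push X g x) = push Y g (onPoints f R x) :=
  NatTrans.naturality_apply f _ x

theorem hom_ext_points {f g : X ⟶ Y} (h : ∀ (R : Type u) [CommRing R] (x : Points X R),
    onPoints f R x = onPoints g R x) : f = g := by
  ext T x
  exact h T.unop.unop x

/-- The points of an ind-affine sheaf are compatible with equalisers of rings. -/
theorem exists_push_of_isIndObject (hX : IsIndObject X) (i : R →+* R') (a b : R' →+* R'')
    (hi : Function.Injective i) (h : ∀ z, a z = b z → ∃ x, i x = z) (x : Points X R')
    (hx : push X a x = push X b x) : ∃ y, push X i y = x := by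
  have := hX.isFiltered
  let P : CostructuredArrow yoneda X := CostructuredArrow.mk
    (yonedaEquiv.symm x : yoneda.obj (op (CommRingCat.of R')) ⟶ X)
  let Q : CostructuredArrow yoneda X := CostructuredArrow.mk
    (yonedaEquiv.symm (push X a x) : yoneda.obj (op (CommRingCat.of R'')) ⟶ X)
  -- As `x` has the same image under `a` and `b`, both maps are arrows from `Q` to `P` over `X`.
  -- Coequalising them gives a ring map `t : B → R'` with `a ∘ t = b ∘ t` through which `x` factors.
  let f : Q ⟶ P := CostructuredArrow.homMk (CommRingCat.ofHom a).op
    (yonedaEquiv_symm_naturality_left _ _ _)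
  let g : Q ⟶ P := CostructuredArrow.homMk (CommRingCat.ofHom b).op
    ((yonedaEquiv_symm_naturality_left _ _ _).trans (congrArg yonedaEquiv.symm hx.symm))
  let B : CommRingCat.{u} := (IsFiltered.coeq f g).left.unop
  let t : B →+* R' := (IsFiltered.coeqHom f g).left.unop.hom
  have ht : ∀ c, a (t c) = b (t c) := fun c =>
    ConcreteCategory.congr_hom (congrArg Quiver.Hom.unop
      (congrArg CommaMorphism.left (IsFiltered.coeq_condition f g))) c
  have htx : push X t (yonedaEquiv (IsFiltered.coeq f g).hom) = x := by
    have h1 : yoneda.map (IsFiltered.coeqHom f g).left ≫ (IsFiltered.coeq f g).hom =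
      yonedaEquiv.symm x := CostructuredArrow.w (IsFiltered.coeqHom f g)
    exact (yonedaEquiv_naturality _ _).trans
      ((congrArg yonedaEquiv h1).trans (yonedaEquiv.apply_symm_apply x))
  -- The image of `t` lies in the equaliser of `a` and `b`, hence in the range of `i`, so `t` lifts
  -- to `s : B → R`.
  let e : R ≃+* i.range := RingEquiv.ofBijective i.rangeRestrict
    ⟨fun _ _ hxy => hi (congrArg Subtype.val hxy), i.rangeRestrict_surjective⟩
  let s : B →+* R := (e.symm : i.range →+* R).comp (t.codRestrict i.range fun c => h _ (ht c))
  have hs : i.comp s = t := RingHom.ext fun c =>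
    congrArg Subtype.val (e.apply_symm_apply (t.codRestrict i.range (fun c => h _ (ht c)) c))
  exact ⟨push X s (yonedaEquiv (IsFiltered.coeq f g).hom), by rw [← push_comp, hs, htx]⟩

/-- A morphism of presheaves given by its values on points. -/
def homOfPoints (φ : ∀ (R : Type u) [CommRing R], Points X R → Points Y R)
    (hφ : ∀ {R R' : Type u} [CommRing R] [CommRing R'] (g : R →+* R') (x : Points X R),
      φ R' (push X g x) = push Y g (φ R x)) : X ⟶ Y where
  app T := TypeCat.ofHom (φ T.unop.unop)
  naturality T T' g := by
    ext x
    exact hφ g.unop.unop.hom x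

end Push

/-! ### From a section of `J^1(X) → X` to a coaction of `J` -/

section JetPoints

variable {p : ℕ} [Fact p.Prime] {X Y Z : PSh.{u}} {R R' : Type u} [CommRing R] [CommRing R']

/-- The map `X(R) → Y(W_n(R))` induced by a morphism `X ⟶ J^n(Y)`. -/
def jetPoints {n : ℕ} (f : X ⟶ (jetN p n).obj Y) (R : Type u) [CommRing R] :
    Points X R → Points Y (Witt p R n) := f.app _

theorem jetPoints_push {n : ℕ} (f : X ⟶ (jetN p n).obj Y) (g : R →+* R') (x : Points X R) :
    jetPoints f R' (push X g x) = push Y (Witt.map p g n) (jetPoints f R x) :=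
  NatTrans.naturality_apply f _ x

/-- The function `X(R) → X(W_n(R))` with `x ↦ r (α_{n-1} (b x))`, where
`r : W_{n-1}(W_1(R)) → W_n(R)` is the retraction. -/
def iterFun (b : X ⟶ (jetN p 1).obj X) :
    ∀ (n : ℕ) (R : Type u) [CommRing R], Points X R → Points X (Witt p R n)
  | 0, R, _, x => push X (Witt.zeroEquiv p R).toRingHom x
  | n + 1, R, _, x => push X (Witt.retraction p R n) (iterFun b n (Witt p R 1) (jetPoints b R x))

theorem iterFun_push (b : X ⟶ (jetN p 1).obj X) (n : ℕ) :
    ∀ {R R' : Type u} [CommRing R] [CommRing R'] (g : R →+* R') (x : Points X R),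
      iterFun b n R' (push X g x) = push X (Witt.map p g n) (iterFun b n R x) := by
  induction n with
  | zero =>
    intro R R' _ _ g x
    rw [iterFun, iterFun, ← push_comp, ← push_comp]
    rfl
  | succ n ih =>
    intro R R' _ _ g x
    rw [iterFun, iterFun, jetPoints_push, ih, ← push_comp, ← push_comp]
    exact push_congr (fun z => (Witt.map_retractionFun p g n z).symm) _

theorem iterFun_one {b : X ⟶ (jetN p 1).obj X} (x : Points X R) :
    iterFun b 1 R x = jetPoints b R x := by
  rw [iterFun, iterFun, ← push_comp]
  exact (push_congr (fun z => rfl) _).trans (push_id _)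

section Sections

variable {b : X ⟶ (jetN p 1).obj X} (hb : b ≫ (jetOneProj p).app X = 𝟙 X)
include hb

theorem push_trunc_jetPoints (x : Points X R) :
    push X ((Witt.zeroEquiv p R).symm.toRingHom.comp (Witt.trunc p R 0)) (jetPoints b R x) = x := by
  rw [push_comp]
  exact congrArg (fun f => onPoints f R x) hb

/-- The two statements are proved together: descent along `Δ` at one level needs both of them at the
level below. -/
theorem iterFun_spec (hX : IsIndObject X) (n : ℕ) :
    ∀ {R : Type u} [CommRing R] (x : Points X R),
      push X (Witt.comul p R 1 n (n + 1) (Witt.one_add_eq _)) (iterFun b (n + 1) R x) =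
        iterFun b n (Witt p R 1) (jetPoints b R x) ∧
      push X (Witt.trunc p R n) (iterFun b (n + 1) R x) = iterFun b n R x := by
  induction n with
  | zero =>
    intro R _ x
    rw [iterFun_one]
    constructor
    · refine push_congr (fun z => ?_) _
      funext i j
      change z _ = z j
      congr 1
      ext
      simp [show i = 0 from Fin.eq_zero i]
    · rw [iterFun]
      conv_rhs => rw [← push_trunc_jetPoints hb x, ← push_comp]
      refine push_congr (fun z => ?_) _
      exact ((Witt.zeroEquiv p R).apply_symm_apply _).symm
  | succ n ih =>
    intro R _ x
    have key : push X (Witt.comul p R 1 (n + 1) (n + 2) (Witt.one_add_eq _))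
        (iterFun b (n + 2) R x) = iterFun b (n + 1) (Witt p R 1) (jetPoints b R x) := by
      -- Both images of `α_{n+1}(b x)` equal `α_n(b x)`: one by compatibility with `τ`, the other
      -- because `W_{n+1}(τ)` sends it to `α_{n+1} x` by naturality and the section property, and
      -- `Δ` then gives `α_n(b x)`.
      obtain ⟨y, hy⟩ := exists_push_of_isIndObject hX
        (Witt.comul p R 1 (n + 1) (n + 2) (Witt.one_add_eq _)) (Witt.trunc p (Witt p R 1) n)
        ((Witt.comul p R 1 n (n + 1) (Witt.one_add_eq _)).comp (Witt.mapTrunc p R (n + 1)))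
        (Witt.comul_injective p (n + 1)) (fun z hz => Witt.exists_comul_eq p z hz)
        (iterFun b (n + 1) (Witt p R 1) (jetPoints b R x)) (by
          rw [(ih _).2, push_comp, Witt.mapTrunc, ← iterFun_push, push_trunc_jetPoints hb,
            (ih x).1])
      rw [iterFun, ← hy, ← push_comp (Witt.comul p R 1 (n + 1) (n + 2) (Witt.one_add_eq _)),
        push_congr (h := RingHom.id _) (fun z => Witt.retraction_comul p z), push_id]
    refine ⟨key, ?_⟩
    -- Compatibility with truncation may be tested after `Δ`, which commutes with `τ`.
    refine push_injective (h := Witt.retraction p R n) (Witt.retraction_comul p) ?_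
    rw [(ih x).1, ← (ih (jetPoints b R x)).2, ← key, ← push_comp, ← push_comp]
    rfl

/-- These are the components of coassociativity. The induction peels off one application of `b`,
replacing `R` by `W_1(R)` and `m + 1` by `m`; the case `m = 0` is naturality. -/
theorem push_comul_iterFun (hX : IsIndObject X) (m : ℕ) :
    ∀ (n k : ℕ) (h : m + n = k) {R : Type u} [CommRing R] (x : Points X R),
      push X (Witt.comul p R m n k h) (iterFun b k R x) =
        iterFun b n (Witt p R m) (iterFun b m R x) := by
  induction m with
  | zero =>
    intro n k h R _ x
    obtain rfl : n = k := by omega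
    conv_rhs => rw [iterFun, iterFun_push]
    refine push_congr (fun z => ?_) _
    funext i j
    change z _ = z i
    congr 1
    ext
    simp [show j = 0 from Fin.eq_zero j]
  | succ m ih =>
    intro n k h R _ x
    obtain rfl : m + n + 1 = k := by omega
    -- `W_n(Δ)` is again split injective, and after applying it the claim follows from the
    -- coassociativity of `Δ` itself.
    refine push_injective (g := Witt.map p (Witt.comul p R 1 m (m + 1) (Witt.one_add_eq _)) n)
      (h := Witt.map p (Witt.retraction p R m) n)
      (fun z => funext fun i => Witt.retraction_comul p (z i)) ?_
    rw [← iterFun_push, (iterFun_spec hb hX m x).1, ← ih n _ rfl,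
      ← (iterFun_spec hb hX (m + n) x).1, ← push_comp, ← push_comp]
    refine push_congr (fun z => ?_) _
    funext i j l
    change z _ = z _
    congr 1
    ext
    simp [add_assoc]

/-- The `δ`-structure on an ind-affine sheaf `X` extending a section `b` of `J^1(X) → X`. -/
def coalgebraOfSection (hX : IsIndObject X) : (jetComonad.{u} p).Coalgebra where
  A := X
  a := homOfPoints (fun R _ x => ⟨fun n => iterFun b n R x, fun n => (iterFun_spec hb hX n x).2⟩)
    fun g x => Subtype.ext (funext fun n => iterFun_push b n g x)
  counit := hom_ext_points fun R _ x => by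
    change push X (Witt.zeroEquiv p R).symm.toRingHom (push X (Witt.zeroEquiv p R).toRingHom x) = x
    rw [← push_comp]
    exact push_id x
  coassoc := hom_ext_points fun R _ x => Subtype.ext <| funext fun m => Subtype.ext <|
    funext fun n => push_comul_iterFun hb hX m n (m + n) rfl x

end Sections

/-! ### Morphisms compatible with `α_1` -/

section Coalgebra

variable (A B : (jetComonad.{u} p).Coalgebra)

theorem jetPoints_coactN_zero (x : Points A.A R) :
    jetPoints (coactN p A 0) R x = push A.A (Witt.zeroEquiv p R).toRingHom x := by
  have h : push A.A (Witt.zeroEquiv p R).symm.toRingHom (jetPoints (coactN p A 0) R x) = x :=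
    congrArg (fun f => onPoints f R x) A.counit
  conv_rhs => rw [← h, ← push_comp]
  exact ((push_congr (h := RingHom.id _)
    (fun z => (Witt.zeroEquiv p R).apply_symm_apply z) _).trans (push_id _)).symm

theorem push_comul_coactN (m n k : ℕ) (h : m + n = k) (x : Points A.A R) :
    push A.A (Witt.comul p R m n k h) (jetPoints (coactN p A k) R x) =
      jetPoints (coactN p A n) (Witt p R m) (jetPoints (coactN p A m) R x) := by
  subst h
  exact congrFun (congrArg Subtype.val (congrFun (congrArg Subtype.val
    (congrArg (fun f => onPoints f R x) A.coassoc)) m)) n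

variable {A B}

/-- A morphism compatible with the maps `α_1` is a `δ`-morphism. -/
def homOfCoactNOne (f : A.A ⟶ B.A)
    (hf : coactN p A 1 ≫ (jetN p 1).map f = f ≫ coactN p B 1) : A ⟶ B where
  f := f
  h := by
    have hf' : ∀ (R : Type u) [CommRing R] (x : Points A.A R),
        onPoints f _ (jetPoints (coactN p A 1) R x) = jetPoints (coactN p B 1) R (onPoints f R x) :=
      fun R _ x => congrArg (fun g => jetPoints g R x) hf
    have key : ∀ (n : ℕ) (R : Type u) [CommRing R] (x : Points A.A R),
        onPoints f _ (jetPoints (coactN p A n) R x) =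
          jetPoints (coactN p B n) R (onPoints f R x) := by
      intro n
      induction n with
      | zero =>
        intro R _ x
        rw [jetPoints_coactN_zero, jetPoints_coactN_zero, onPoints_push]
      | succ n ih =>
        intro R _ x
        -- After `Δ`, the map `α_{n+1}` becomes `α_n ∘ α_1`, and `f` commutes with both factors.
        -- Only the splitting of `Δ` enters, so the coalgebras need not be ind-affine.
        refine push_injective (g := Witt.comul p R 1 n (n + 1) (Witt.one_add_eq _))
          (Witt.retraction_comul p) ?_
        rw [← onPoints_push, push_comul_coactN, push_comul_coactN, ih, hf']
    exact hom_ext_points fun R _ x => Subtype.ext (funext fun n => key n R x)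

end Coalgebra

end JetPoints

/-! ### The equivalence of categories -/

section Equivalence

variable {p : ℕ} [Fact p.Prime] (S : DeltaSheaf.{u} p)

instance toJetSection_faithful : (toJetSection S).Faithful where
  map_injective {X Y} f g h := by
    apply ObjectProperty.hom_ext
    apply Over.OverMorphism.ext
    apply ObjectProperty.hom_ext
    apply Comonad.Coalgebra.Hom.ext
    exact congrArg (fun t => t.hom.f.left) h

/-- Projecting from `J^1_S` to `J^1` turns the relative compatibility into the absolute one that
`homOfCoactNOne` requires. -/
theorem coactN_one_naturality_of_hom {X Y : IndAffineDeltaSheaf S}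
    (g : (toJetSection S).obj X ⟶ (toJetSection S).obj Y) :
    coactN p X.obj.left.obj 1 ≫ (jetN p 1).map g.hom.f.left =
      g.hom.f.left ≫ coactN p Y.obj.left.obj 1 := by
  have h := congrArg (fun t => t.left ≫
    pullback.fst ((jetN p 1).map Y.obj.hom.hom.f) (coactN p S.obj 1)) g.hom.h
  refine Eq.trans ?_ (h.trans ?_)
  · refine Eq.trans ?_ (Category.assoc _ _ _).symm
    refine Eq.trans ?_ (congrArg (fun t => (relCoactOne S X.obj).left ≫ t)
      (pullback.lift_fst _ _ _).symm)
    refine Eq.trans ?_ (Category.assoc _ _ _)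
    exact congrArg (fun t => t ≫ (jetN p 1).map g.hom.f.left) (relCoactOne_fst S X.obj).symm
  · refine (Category.assoc _ _ _).trans ?_
    exact congrArg (fun t => g.hom.f.left ≫ t) (relCoactOne_fst S Y.obj)

instance toJetSection_full : (toJetSection S).Full where
  map_surjective {X Y} g := by
    let f : X.obj.left.obj ⟶ Y.obj.left.obj :=
      homOfCoactNOne g.hom.f.left (coactN_one_naturality_of_hom S g)
    exact ⟨ObjectProperty.homMk (Over.homMk (ObjectProperty.homMk f)
      (ObjectProperty.hom_ext _ (Comonad.Coalgebra.Hom.ext (Over.w g.hom.f)))), rfl⟩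

section EssSurj

variable {S} (C : JetSection S)

/-- The map `X ⟶ J^1(X)` underlying a section `X ⟶ J^1_S(X)`. -/
def jetSectionMap : C.obj.V.left ⟶ (jetN p 1).obj C.obj.V.left :=
  C.obj.str.left ≫ pullback.fst ((jetN p 1).map C.obj.V.hom) (coactN p S.obj 1)

theorem jetSectionMap_proj :
    jetSectionMap C ≫ (jetOneProj p).app C.obj.V.left = 𝟙 C.obj.V.left :=
  (Category.assoc _ _ _).trans (congrArg (fun t => t.left) C.property.2)

/-- This is the fibre product condition for `β`, a morphism over `S`; it makes the structure map `X
→ S` a `δ`-morphism. -/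
theorem jetSectionMap_comp :
    jetSectionMap C ≫ (jetN p 1).map C.obj.V.hom = C.obj.V.hom ≫ coactN p S.obj 1 := by
  refine (Category.assoc _ _ _).trans ?_
  refine (congrArg (fun t => C.obj.str.left ≫ t) pullback.condition).trans ?_
  refine (Category.assoc _ _ _).symm.trans ?_
  exact congrArg (fun t => t ≫ coactN p S.obj 1) (Over.w C.obj.str)

/-- The `δ`-structure on `X` determined by a section `X ⟶ J^1_S(X)`. -/
def coalgebraOfJetSection : (jetComonad.{u} p).Coalgebra :=
  coalgebraOfSection (jetSectionMap_proj C) C.property.1.2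

theorem coactN_one_coalgebraOfJetSection :
    coactN p (coalgebraOfJetSection C) 1 = jetSectionMap C :=
  hom_ext_points fun _ _ x => iterFun_one x

/-- The ind-affine `δ_S`-sheaf determined by a section `X ⟶ J^1_S(X)`. -/
def deltaSheafOfJetSection : IndAffineDeltaSheaf S where
  obj := Over.mk (Y := (⟨coalgebraOfJetSection C, C.property.1.1⟩ : DeltaSheaf p))
    (ObjectProperty.homMk (homOfCoactNOne (A := coalgebraOfJetSection C) C.obj.V.hom
      ((congrArg (fun t => t ≫ (jetN p 1).map C.obj.V.hom)
        (coactN_one_coalgebraOfJetSection C)).trans (jetSectionMap_comp C))))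
  property := C.property.1

/-- Morphisms into `J^1_S(X)` are compared on the two projections: to `J^1(X)` both give the map
underlying `β`, and to `S` both give the structure map. -/
theorem relCoactOne_deltaSheafOfJetSection :
    relCoactOne S (deltaSheafOfJetSection C).obj = C.obj.str := by
  apply Over.OverMorphism.ext
  apply pullback.hom_ext
  · exact (relCoactOne_fst S _).trans (coactN_one_coalgebraOfJetSection C)
  · exact (Over.w (relCoactOne S (deltaSheafOfJetSection C).obj)).trans (Over.w C.obj.str).symm

/-- The `δ_S`-sheaf determined by a section `X ⟶ J^1_S(X)` recovers this section. -/
def toJetSectionObjIso : (toJetSection S).obj (deltaSheafOfJetSection C) ≅ C :=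
  ObjectProperty.isoMk _ (Endofunctor.Coalgebra.isoMk (Iso.refl C.obj.V) <|
    (congrArg (fun t => relCoactOne S (deltaSheafOfJetSection C).obj ≫ t)
      ((relJetN p S.obj 1).map_id C.obj.V)).trans <|
    (Category.comp_id _).trans <|
    (relCoactOne_deltaSheafOfJetSection C).trans (Category.id_comp _).symm)

end EssSurj

instance toJetSection_essSurj : (toJetSection S).EssSurj where
  mem_essImage C := ⟨_, ⟨toJetSectionObjIso C⟩⟩

instance toJetSection_isEquivalence : (toJetSection S).IsEquivalence where

end Equivalence

end DeltaJet

end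

theorem proposition2p3p1 (p : ℕ) [Fact p.Prime] (S : DeltaJet.DeltaSheaf.{u} p) :
    (DeltaJet.toJetSection S).IsEquivalence ∧
    ∀ (R : Type u) [CommRing R] (n : ℕ),
      Function.Injective (DeltaJet.Witt.comul p R 1 (n + 1) (n + 2) (by omega)) ∧
      Set.range (DeltaJet.Witt.comul p R 1 (n + 1) (n + 2) (by omega)) =
        {z : DeltaJet.Witt p (DeltaJet.Witt p R 1) (n + 1) |
          DeltaJet.Witt.trunc p (DeltaJet.Witt p R 1) n z =
            DeltaJet.Witt.comul p R 1 n (n + 1) (by omega)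
              (DeltaJet.Witt.map p
                ((DeltaJet.Witt.zeroEquiv p R).symm.toRingHom.comp (DeltaJet.Witt.trunc p R 0))
                (n + 1) z)} := by
  refine ⟨inferInstance, fun R _ n => ⟨DeltaJet.Witt.comul_injective p (n + 1), ?_⟩⟩
  ext z
  constructor
  · rintro ⟨x, rfl⟩
    exact DeltaJet.Witt.trunc_comul p x
  · exact DeltaJet.Witt.exists_comul_eq p z
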